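/- Let $\Omega$ be a Polish space with its Borel $\sigma$-field $\mathfrak B$, and let $\Theta$ be the set of all probability measures on $(\Omega,\mathfrak B)$. The $\tau$-topology on $\Theta$ is the coarsest topology for which $P\mapsto P(B)$ is continuous for every $B\in\mathfrak B$; the weak topology is the coarsest topology for which $P\mapsto\int_\Omega f\,dP$ is continuous for every bounded continuous $f:\Omega\to\mathbb R$. Write $\mathfrak{cl}_c$ for the closure in $\Theta$ in the weak topology. A subset of $\Theta$ is called relatively compact in one of these topologies if its closure in $\Theta$ in that topology is compact in that topology. Let $\Theta_0,\Theta_1\subset\Theta$. Given independent observations $X_1,\dots,X_n$ with common law $P$, consider the hypothesis $H_0: P\in\Theta_0$ and the alternative $H_1: P\in\Theta_1$. A test of sample size $n$ is a measurable function $K_n:\Omega^n\to[0,1]$ (the probability of rejecting $H_0$), and $$\alpha(K_n)=\sup_{P\in\Theta_0}\int_{\Omega^n} K_n\,dP^{\otimes n},\qquad \beta(K_n)=\sup_{P\in\Theta_1}\int_{\Omega^n}(1-K_n)\,dP^{\otimes n},$$ where the supremum over the empty set is $0$. $H_0$ and $H_1$ are called indistinguishable if $\alpha(K_n)+\beta(K_n)\ge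 1$ for every $n\ge 1$ and every test $K_n$ of sample size $n$. They are called distinguishable if for every $a\in(0,1)$ there is a sequence of tests $K_n$, $n\ge1$, with $\alpha(K_n)<a$ for all $n\ge1$ and $\lim_{n\to\infty}\beta(K_n)=0$. **Theorem.** (i) If $\Theta_0$ and $\Theta_1$ are both relatively compact in the $\tau$-topology and $\mathfrak{cl}_c(\Theta_0)\cap\mathfrak{cl}_c(\Theta_1)\neq\emptyset$, then $H_0$ and $H_1$ are indistinguishable. (ii) If $\Theta_0$ or $\Theta_1$ is relatively compact in the weak topology and $\mathfrak{cl}_c(\Theta_0)\cap\mathfrak{cl}_c(\Theta_1)=\emptyset$, then $H_0$ and $H_1$ are distinguishable. Moreover, there exist a sequence of tests $K_n$, a constant $c>0$ and an $n_0$ such that, for all $n>n_0$, $$\alpha(K_n)\le e^{-cn}\quad\text{and}\quad\beta(K_n)\le e^{-cn}.$$ -/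

import Mathlib

open MeasureTheory Filter Topology

noncomputable section

namespace IIDTesting

/-- The `τ`-topology (topology of setwise convergence): the coarsest topology on the set of all
probability measures on `Ω` for which `P ↦ P B` is continuous for every measurable set `B`. -/
abbrev tauTopology (Ω : Type*) [MeasurableSpace Ω] : TopologicalSpace (ProbabilityMeasure Ω) :=
  ⨅ B : {B : Set Ω // MeasurableSet B},
    TopologicalSpace.induced (fun P : ProbabilityMeasure Ω => P (B : Set Ω)) inferInstance

/-- Relative compactness in the `τ`-topology: the `τ`-closure is `τ`-compact. -/
def RelCompactTau {Ω : Type*} [MeasurableSpace Ω] (Ψ : Set (ProbabilityMeasure Ω)) : Prop :=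
  @IsCompact _ (tauTopology Ω) (@closure _ (tauTopology Ω) Ψ)

/-- Relative compactness in the weak topology, which is the topology that Mathlib puts on
`ProbabilityMeasure Ω`: the weak closure is weakly compact. -/
def RelCompactWeak {Ω : Type*} [MeasurableSpace Ω] [TopologicalSpace Ω] [OpensMeasurableSpace Ω]
    (Ψ : Set (ProbabilityMeasure Ω)) : Prop :=
  IsCompact (closure Ψ)

/-- A (possibly randomized) test based on a sample of size `n`: a measurable function of the
observations with values in `[0, 1]`, the probability of rejecting the hypothesis. -/
structure SampleTest (Ω : Type*) [MeasurableSpace Ω] (n : ℕ) where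
  toFun : (Fin n → Ω) → ℝ
  measurable_toFun : Measurable toFun
  mem_Icc : ∀ x, toFun x ∈ Set.Icc (0 : ℝ) 1

namespace SampleTest

variable {Ω : Type*} [MeasurableSpace Ω] {n : ℕ}

/-- Type I error probability at `P`: the expectation of `K (X₁, …, Xₙ)` for independent `Xᵢ`
with law `P`. -/
def errorI (K : SampleTest Ω n) (P : ProbabilityMeasure Ω) : ℝ :=
  ∫ x, K.toFun x ∂(Measure.pi fun _ : Fin n => (P : Measure Ω))

/-- Type II error probability at `P`: the expectation of `1 - K (X₁, …, Xₙ)`. -/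
def errorII (K : SampleTest Ω n) (P : ProbabilityMeasure Ω) : ℝ :=
  ∫ x, (1 - K.toFun x) ∂(Measure.pi fun _ : Fin n => (P : Measure Ω))

/-- `α(K)`, the supremum over `Θ₀` of the type I error probabilities, which lie in `[0, 1]`
(the supremum over the empty set is `0`). -/
def alpha (K : SampleTest Ω n) (Θ₀ : Set (ProbabilityMeasure Ω)) : ℝ :=
  ⨆ P : Θ₀, K.errorI P

/-- `β(K)`, the supremum over `Θ₁` of the type II error probabilities. -/
def beta (K : SampleTest Ω n) (Θ₁ : Set (ProbabilityMeasure Ω)) : ℝ :=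
  ⨆ P : Θ₁, K.errorII P

end SampleTest

/-- Indistinguishability: `α(K) + β(K) ≥ 1` for every test of every sample size `n = 1, 2, …`. -/
def Indistinguishable {Ω : Type*} [MeasurableSpace Ω] (Θ₀ Θ₁ : Set (ProbabilityMeasure Ω)) :
    Prop :=
  ∀ n : ℕ, 1 ≤ n → ∀ K : SampleTest Ω n, 1 ≤ K.alpha Θ₀ + K.beta Θ₁

/-- Distinguishability: for every level `0 < a < 1` there are tests `Kₙ` with `α(Kₙ) < a` for
all `n = 1, 2, …` and `β(Kₙ) → 0`. -/
def Distinguishable {Ω : Type*} [MeasurableSpace Ω] (Θ₀ Θ₁ : Set (ProbabilityMeasure Ω)) :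
    Prop :=
  ∀ a : ℝ, 0 < a → a < 1 → ∃ K : (n : ℕ) → SampleTest Ω n,
    (∀ n : ℕ, 1 ≤ n → (K n).alpha Θ₀ < a) ∧
      Tendsto (fun n : ℕ => (K n).beta Θ₁) atTop (𝓝 0)

end IIDTesting

end

/-! For (i), the error probabilities of a fixed test are `τ`-continuous in `P` on a `τ`-compact set.
By Dini, the laws in such a set are uniformly countably additive; this passes to `n`-fold products,
and a π-λ argument then extends continuity from boxes to all measurable sets and, by uniform
approximation, to `[0,1]`-valued functions. So `α` and `β` also bound the errors at points of the
`τ`-closures. These contain the weak closures, since a `τ`-compact set is weakly compact, hence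
weakly closed. At a common point the two errors sum to `1`.

For (ii), weak neighbourhoods involve finitely many bounded continuous functions, so compactness of
one closure yields a finite family `S` and one gap `ε` separating the hypotheses. Rejecting when no
`P ∈ Θ₀` matches all empirical means of `S` to within `ε / 2` has exponentially small errors by
Hoeffding. -/

noncomputable section

namespace IIDTesting

open scoped BoundedContinuousFunction

/-! ### Setwise continuity of product measures on compact sets -/

section SetwiseContinuity

variable {X Y : Type*} [MeasurableSpace Y]

/-- Uniform countable additivity, on `C`, of a family of measures. -/
def UniformlyCountablyAdditive (μ : X → Measure Y) (C : Set X) : Prop :=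
  ∀ A : ℕ → Set Y, (∀ m, MeasurableSet (A m)) → Antitone A → ⋂ m, A m = ∅ →
    ∀ ε : ℝ, 0 < ε → ∃ m, ∀ x ∈ C, (μ x).real (A m) ≤ ε

lemma tendsto_measureReal_of_antitone (μ : Measure Y) [IsFiniteMeasure μ] {A : ℕ → Set Y}
    (hA : ∀ m, MeasurableSet (A m)) (hanti : Antitone A) (hempty : ⋂ m, A m = ∅) :
    Tendsto (fun m => μ.real (A m)) atTop (𝓝 0) := by
  have h := tendsto_measure_iInter_atTop (μ := μ) (fun m => (hA m).nullMeasurableSet) hanti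
    ⟨0, measure_ne_top _ _⟩
  rw [hempty, measure_empty] at h
  exact (ENNReal.tendsto_toReal ENNReal.zero_ne_top).comp h

/-- Dini's theorem: continuous functions decreasing pointwise to `0` on a compact set do so
uniformly. -/
lemma uniformlyCountablyAdditive_of_isCompact [TopologicalSpace X] {μ : X → Measure Y}
    [∀ x, IsProbabilityMeasure (μ x)] {C : Set X} (hC : IsCompact C)
    (hμ : ∀ A, MeasurableSet A → ContinuousOn (fun x => (μ x).real A) C) :
    UniformlyCountablyAdditive μ C := by
  intro A hA hanti hempty ε hε
  have h := Antitone.tendstoUniformlyOn_of_forall_tendsto (F := fun m x => (μ x).real (A m))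
    (f := fun _ => (0 : ℝ)) hC (fun m => hμ _ (hA m))
    (fun x _ i j hij => measureReal_mono (hanti hij)) continuousOn_const
    (fun x _ => tendsto_measureReal_of_antitone (μ x) hA hanti hempty)
  obtain ⟨m, hm⟩ := (Metric.tendstoUniformlyOn_iff.1 h ε hε).exists
  refine ⟨m, fun x hx => ?_⟩
  have := hm x hx
  rw [dist_comm, Real.dist_eq, sub_zero] at this
  exact (le_abs_self _).trans this.le

/-- Fubini, splitting off the first coordinates whose sections are large. Arguing by contradiction
reduces `C` to a sequence `p`, so that the exceptional sets `B m` are countable unions and hence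
measurable. Additivity of `ν` makes them decrease to `∅`; additivity of `μ` then makes them
uniformly small. -/
lemma UniformlyCountablyAdditive.prod {Z : Type*} [MeasurableSpace Z] {μ : X → Measure Y}
    {ν : X → Measure Z} [∀ x, IsProbabilityMeasure (μ x)] [∀ x, IsProbabilityMeasure (ν x)]
    {C : Set X} (hμ : UniformlyCountablyAdditive μ C) (hν : UniformlyCountablyAdditive ν C) :
    UniformlyCountablyAdditive (fun x => (μ x).prod (ν x)) C := by
  intro A hA hanti hempty ε hε
  by_contra! hcon
  choose p hpC hp using hcon
  set B : ℕ → Set Y := fun m => {y | ∃ j, ENNReal.ofReal (ε / 2) < ν (p j) (Prod.mk y ⁻¹' A m)}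
    with hB
  have hBmeas : ∀ m, MeasurableSet (B m) := fun m => by
    simp only [hB, Set.ofPred_exists]
    exact MeasurableSet.iUnion fun j =>
      measurableSet_lt measurable_const (measurable_measure_prodMk_left (hA m))
  have hBanti : Antitone B := fun m k hmk y ⟨j, hj⟩ =>
    ⟨j, hj.trans_le (measure_mono (Set.preimage_mono (hanti hmk)))⟩
  have hBempty : ⋂ m, B m = ∅ := by
    refine Set.eq_empty_iff_forall_notMem.2 fun y hy => ?_
    obtain ⟨m, hm⟩ := hν (fun m => Prod.mk y ⁻¹' A m) (fun m => measurable_prodMk_left (hA m))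
      (fun i j hij => Set.preimage_mono (hanti hij))
      (by rw [← Set.preimage_iInter, hempty, Set.preimage_empty]) (ε / 2) (half_pos hε)
    obtain ⟨j, hj⟩ := Set.mem_iInter.1 hy m
    refine absurd hj (not_lt.2 ?_)
    rw [← ENNReal.ofReal_toReal (measure_ne_top (ν (p j)) _)]
    exact ENNReal.ofReal_le_ofReal (hm _ (hpC j))
  obtain ⟨m, hm⟩ := hμ B hBmeas hBanti hBempty (ε / 2) (half_pos hε)
  have key : ((μ (p m)).prod (ν (p m))) (A m) ≤ ENNReal.ofReal ε := by
    rw [Measure.prod_apply (hA m)]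
    calc ∫⁻ y, ν (p m) (Prod.mk y ⁻¹' A m) ∂(μ (p m))
        ≤ ∫⁻ y, (ENNReal.ofReal (ε / 2) + (B m).indicator 1 y) ∂(μ (p m)) := by
          refine lintegral_mono fun y => ?_
          by_cases hy : y ∈ B m
          · simp only [hy, Set.indicator_of_mem, Pi.one_apply]
            exact prob_le_one.trans le_add_self
          · simp only [hy, not_false_eq_true, Set.indicator_of_notMem, add_zero]
            by_contra! h
            exact hy ⟨m, h⟩
      _ = ENNReal.ofReal (ε / 2) + μ (p m) (B m) := by
          rw [lintegral_add_left measurable_const, lintegral_indicator_one (hBmeas m)]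
          simp
      _ ≤ ENNReal.ofReal (ε / 2) + ENNReal.ofReal (ε / 2) := by
          gcongr
          rw [← ENNReal.ofReal_toReal (measure_ne_top (μ (p m)) _)]
          exact ENNReal.ofReal_le_ofReal (hm _ (hpC m))
      _ = ENNReal.ofReal ε := by
          rw [← ENNReal.ofReal_add (by positivity) (by positivity), add_halves]
  exact absurd (ENNReal.toReal_le_of_le_ofReal hε.le key) (not_le.2 (hp m))

lemma UniformlyCountablyAdditive.pi {μ : X → Measure Y} [∀ x, IsProbabilityMeasure (μ x)]
    {C : Set X} (hμ : UniformlyCountablyAdditive μ C) (n : ℕ) :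
    UniformlyCountablyAdditive (fun x => Measure.pi fun _ : Fin n => μ x) C := by
  induction n with
  | zero =>
    intro A hA hanti hempty ε hε
    obtain ⟨m, hm⟩ : ∃ m, (fun i => i.elim0 : Fin 0 → Y) ∉ A m := by
      simpa using Set.eq_empty_iff_forall_notMem.1 hempty (fun i => i.elim0)
    refine ⟨m, fun x _ => ?_⟩
    have : A m = ∅ := Set.eq_empty_iff_forall_notMem.2 fun y hy =>
      hm (Subsingleton.elim y (fun i => i.elim0) ▸ hy)
    simp [this, hε.le]
  | succ n ih =>
    intro A hA hanti hempty ε hε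
    set e := MeasurableEquiv.piFinSuccAbove (fun _ : Fin (n + 1) => Y) 0
    obtain ⟨m, hm⟩ := hμ.prod ih (fun m => e.symm ⁻¹' A m) (fun m => e.symm.measurable (hA m))
      (fun i j hij => Set.preimage_mono (hanti hij))
      (by rw [← Set.preimage_iInter, hempty, Set.preimage_empty]) ε hε
    refine ⟨m, fun x hx => ?_⟩
    have h := ((measurePreserving_piFinSuccAbove (fun _ : Fin (n + 1) => μ x) 0).symm
      |>.measureReal_preimage (hA m).nullMeasurableSet)
    rw [← h]
    exact hm x hx

variable [TopologicalSpace X]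

/-- π-λ induction. For disjoint unions, the tails decrease to `∅`, so uniform countable additivity
makes the partial sums converge uniformly, which preserves continuity. -/
lemma continuousOn_measureReal_of_isPiSystem {μ : X → Measure Y}
    [∀ x, IsProbabilityMeasure (μ x)] {C : Set X} (hμ : UniformlyCountablyAdditive μ C)
    {S : Set (Set Y)} (hgen : ‹MeasurableSpace Y› = MeasurableSpace.generateFrom S)
    (hS : IsPiSystem S) (hcont : ∀ s ∈ S, ContinuousOn (fun x => (μ x).real s) C)
    {A : Set Y} (hA : MeasurableSet A) : ContinuousOn (fun x => (μ x).real A) C := by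
  induction A, hA using MeasurableSpace.induction_on_inter hgen hS with
  | empty => simpa using continuousOn_const
  | basic t ht => exact hcont t ht
  | compl t htm ih =>
    simp_rw [probReal_compl_eq_one_sub htm]
    exact continuousOn_const.sub ih
  | iUnion f hdisj hfm ih =>
    set R : ℕ → Set Y := fun m => ⋃ i, ⋃ (_ : m ≤ i), f i with hR
    have hRm : ∀ m, MeasurableSet (R m) := fun m =>
      MeasurableSet.iUnion fun i => MeasurableSet.iUnion fun _ => hfm i
    have hRanti : Antitone R := fun m k hmk =>
      Set.iUnion_mono fun i => Set.iUnion_mono' fun h => ⟨hmk.trans h, subset_rfl⟩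
    have hRempty : ⋂ m, R m = ∅ := by
      refine Set.eq_empty_iff_forall_notMem.2 fun y hy => ?_
      have hy' : ∀ m, ∃ i, m ≤ i ∧ y ∈ f i := fun m => by
        simpa [hR] using Set.mem_iInter.1 hy m
      obtain ⟨i, -, hi⟩ := hy' 0
      obtain ⟨j, hij, hj⟩ := hy' (i + 1)
      exact Set.disjoint_left.1 (hdisj (by omega : i ≠ j)) hi hj
    have hsplit : ∀ m x, (μ x).real (⋃ i, f i)
        = ∑ i ∈ Finset.range m, (μ x).real (f i) + (μ x).real (R m) := fun m x => by
      rw [← measureReal_biUnion_finset (fun i _ j _ hij => hdisj hij) (fun i _ => hfm i),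
        ← measureReal_union _ (hRm m) (measure_ne_top _ _) (measure_ne_top _ _)]
      · congr 1
        ext y
        simp only [hR, Set.mem_iUnion, Set.mem_union, Finset.mem_range, exists_prop]
        constructor
        · rintro ⟨i, hi⟩
          rcases lt_or_ge i m with h | h
          exacts [Or.inl ⟨i, h, hi⟩, Or.inr ⟨i, h, hi⟩]
        · rintro (⟨i, -, hi⟩ | ⟨i, -, hi⟩) <;> exact ⟨i, hi⟩
      · simp only [hR, Set.disjoint_iUnion_left, Set.disjoint_iUnion_right, Finset.mem_range]
        intro i hi j hj
        exact hdisj (by omega)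
    have hunif : TendstoUniformlyOn (fun m x => ∑ i ∈ Finset.range m, (μ x).real (f i))
        (fun x => (μ x).real (⋃ i, f i)) atTop C := by
      rw [Metric.tendstoUniformlyOn_iff]
      intro ε hε
      obtain ⟨m, hm⟩ := hμ R hRm hRanti hRempty (ε / 2) (half_pos hε)
      filter_upwards [eventually_ge_atTop m] with k hk x hx
      rw [hsplit k x, Real.dist_eq, add_sub_cancel_left, abs_of_nonneg measureReal_nonneg]
      have := (measureReal_mono (μ := μ x) (hRanti hk) (measure_ne_top _ _)).trans (hm x hx)
      linarith
    exact hunif.continuousOn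
      (Frequently.of_forall fun m => continuousOn_finsetSum _ fun i _ => ih i)

/-- The sum is the staircase value `⌊(N + 1) * t⌋₊ / (N + 1)`. -/
lemma abs_sub_sum_indicator_le (N : ℕ) {t : ℝ} (ht : t ∈ Set.Icc (0 : ℝ) 1) :
    |t - ∑ j ∈ Finset.range (N + 1),
      (if ((j : ℝ) + 1) ≤ (N + 1) * t then (1 : ℝ) / (N + 1) else 0)| ≤ 1 / (N + 1) := by
  have hN : (0 : ℝ) < N + 1 := by positivity
  have h0 : 0 ≤ (N + 1) * t := mul_nonneg hN.le ht.1
  have hle : ⌊(N + 1) * t⌋₊ ≤ N + 1 := by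
    refine Nat.floor_le_of_le ?_
    push_cast
    nlinarith [ht.2]
  have hfilter : (Finset.range (N + 1)).filter (fun j : ℕ => ((j : ℝ) + 1) ≤ (N + 1) * t)
      = Finset.range ⌊(N + 1) * t⌋₊ := by
    ext j
    have : ((j : ℝ) + 1) ≤ (N + 1) * t ↔ j + 1 ≤ ⌊(N + 1) * t⌋₊ := by
      rw [Nat.le_floor_iff h0]; push_cast; rfl
    simp only [Finset.mem_filter, Finset.mem_range, this]
    omega
  rw [← Finset.sum_filter, hfilter, Finset.sum_const, Finset.card_range, nsmul_eq_mul]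
  have h1 := Nat.floor_le h0
  have h2 := Nat.lt_floor_add_one ((N + 1) * t)
  rw [abs_le, le_div_iff₀ hN]
  have e : (t - ⌊(N + 1) * t⌋₊ * (1 / (N + 1))) = ((N + 1) * t - ⌊(N + 1) * t⌋₊) / (N + 1) := by
    field_simp
  rw [e]
  constructor
  · have : 0 ≤ ((N + 1) * t - ⌊(N + 1) * t⌋₊) / (N + 1) := div_nonneg (by linarith) hN.le
    have : (0 : ℝ) ≤ 1 / (N + 1) := by positivity
    linarith
  · rw [div_mul_cancel₀ _ hN.ne']
    linarith

lemma continuousOn_integral_of_mem_Icc {μ : X → Measure Y} [∀ x, IsProbabilityMeasure (μ x)]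
    {C : Set X} (hμ : ∀ A, MeasurableSet A → ContinuousOn (fun x => (μ x).real A) C)
    {K : Y → ℝ} (hK : Measurable K) (hK01 : ∀ y, K y ∈ Set.Icc (0 : ℝ) 1) :
    ContinuousOn (fun x => ∫ y, K y ∂(μ x)) C := by
  set A : ℕ → ℕ → Set Y := fun N j => {y | (j : ℝ) + 1 ≤ (N + 1) * K y} with hAdef
  have hA : ∀ N j, MeasurableSet (A N j) := fun N j =>
    measurableSet_le measurable_const (hK.const_mul _)
  have hKint : ∀ x, Integrable K (μ x) := fun x =>
    Integrable.of_mem_Icc 0 1 hK.aemeasurable (Eventually.of_forall hK01)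
  set F : ℕ → X → ℝ := fun N x => ∑ j ∈ Finset.range (N + 1), (μ x).real (A N j) * (1 / (N + 1))
  have hF : ∀ N x, F N x = ∫ y, ∑ j ∈ Finset.range (N + 1),
      (A N j).indicator (fun _ => (1 : ℝ) / (N + 1)) y ∂(μ x) := fun N x => by
    rw [integral_finsetSum _ fun j _ => (integrable_const _).indicator (hA N j)]
    exact Finset.sum_congr rfl fun j _ => by
      rw [integral_indicator_const _ (hA N j), smul_eq_mul]
  have hunif : TendstoUniformlyOn F (fun x => ∫ y, K y ∂(μ x)) atTop C := by
    rw [Metric.tendstoUniformlyOn_iff]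
    intro ε hε
    filter_upwards [(tendsto_one_div_add_atTop_nhds_zero_nat (𝕜 := ℝ)).eventually
      (gt_mem_nhds hε)] with N hN x _
    rw [hF, Real.dist_eq, ← integral_sub (hKint x)
      (integrable_finsetSum _ fun j _ => (integrable_const _).indicator (hA N j))]
    refine lt_of_le_of_lt ?_ hN
    have := norm_integral_le_of_norm_le_const (μ := μ x) (C := (1 : ℝ) / (N + 1))
      (f := fun y => K y - ∑ j ∈ Finset.range (N + 1),
        (A N j).indicator (fun _ => (1 : ℝ) / (N + 1)) y)
      (Eventually.of_forall fun y => by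
        simpa [Set.indicator_apply, hAdef] using abs_sub_sum_indicator_le N (hK01 y))
    simpa using this
  exact hunif.continuousOn (Frequently.of_forall fun N =>
    continuousOn_finsetSum _ fun j _ => (hμ _ (hA N j)).mul continuousOn_const)

lemma continuousOn_integral_pi {μ : X → Measure Y} [∀ x, IsProbabilityMeasure (μ x)]
    {C : Set X} (hC : IsCompact C)
    (hμ : ∀ A, MeasurableSet A → ContinuousOn (fun x => (μ x).real A) C) {n : ℕ}
    {K : (Fin n → Y) → ℝ} (hK : Measurable K) (hK01 : ∀ y, K y ∈ Set.Icc (0 : ℝ) 1) :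
    ContinuousOn (fun x => ∫ y, K y ∂(Measure.pi fun _ : Fin n => μ x)) C := by
  refine continuousOn_integral_of_mem_Icc (fun A hA => ?_) hK hK01
  refine continuousOn_measureReal_of_isPiSystem
    ((uniformlyCountablyAdditive_of_isCompact hC hμ).pi n) generateFrom_pi.symm isPiSystem_pi
    ?_ hA
  rintro _ ⟨s, hs, rfl⟩
  simp only [Set.mem_pi, Set.mem_univ, Set.mem_ofPred_eq, forall_const] at hs
  simp only [Measure.real, Measure.pi_pi, ENNReal.toReal_prod]
  exact continuousOn_finsetProd _ fun i _ => hμ _ (hs i)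

end SetwiseContinuity

/-! ### Finite separation in the weak topology -/

section Separation

variable {Ω : Type*} [TopologicalSpace Ω] [MeasurableSpace Ω] [BorelSpace Ω]

lemma exists_finset_separating_point {F : Set (ProbabilityMeasure Ω)} (hF : IsClosed F)
    {P : ProbabilityMeasure Ω} (hP : P ∉ F) :
    ∃ t ∈ 𝓝 P, ∃ (S : Finset (Ω →ᵇ ℝ)) (ε : ℝ), 0 < ε ∧ ∀ P' ∈ t, ∀ Q ∈ F,
      ∃ f ∈ S, ε ≤ |∫ ω, f ω ∂(P' : Measure Ω) - ∫ ω, f ω ∂(Q : Measure Ω)| := by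
  set T : ProbabilityMeasure Ω → (Ω →ᵇ ℝ) → ℝ := fun Q f => ∫ ω, f ω ∂(Q : Measure Ω)
  have hcomap : 𝓝 P = comap T (𝓝 (T P)) := by
    refine le_antisymm ?_ ?_
    · refine tendsto_iff_comap.1 (tendsto_pi_nhds.2 fun f => ?_)
      exact ProbabilityMeasure.tendsto_iff_forall_integral_tendsto.1 tendsto_id f
    · exact ProbabilityMeasure.tendsto_iff_forall_integral_tendsto.2 fun f =>
        (tendsto_pi_nhds.1 (tendsto_comap (f := T) (x := 𝓝 (T P)))) f
  have hmem : Fᶜ ∈ comap T (𝓝 (T P)) := hcomap ▸ hF.isOpen_compl.mem_nhds hP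
  obtain ⟨u, hu, huF⟩ := mem_comap.1 hmem
  rw [nhds_pi, Filter.mem_pi] at hu
  obtain ⟨I, hI, v, hv, hvu⟩ := hu
  choose δ hδ hball using fun f => Metric.mem_nhds_iff.1 (hv f)
  obtain ⟨ε, hε, hεI⟩ : ∃ ε : ℝ, 0 < ε ∧ ∀ f ∈ I, ε ≤ δ f := by
    rcases hI.toFinset.eq_empty_or_nonempty with h | h
    · exact ⟨1, one_pos, fun f hf => by simp_all⟩
    · refine ⟨hI.toFinset.inf' h δ, (Finset.lt_inf'_iff h).2 fun f _ => hδ f, fun f hf => ?_⟩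
      exact Finset.inf'_le _ (hI.mem_toFinset.2 hf)
  -- Half of the radius is spent on moving from `P` to a nearby `P'`; the other half remains as the
  -- gap, uniform over the neighbourhood.
  refine ⟨T ⁻¹' (I.pi fun f => Metric.ball (T P f) (ε / 2)), ?_, hI.toFinset, ε / 2,
    half_pos hε, fun P' hP' Q hQ => ?_⟩
  · rw [hcomap]
    exact preimage_mem_comap (set_pi_mem_nhds hI fun f _ => Metric.ball_mem_nhds _ (half_pos hε))
  · by_contra! hcon
    refine huF (hvu fun f hf => hball f ?_ : T Q ∈ u) hQ
    have h1 : |T P' f - T P f| < ε / 2 := hP' f hf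
    have h2 : |T P' f - T Q f| < ε / 2 := hcon f (hI.mem_toFinset.2 hf)
    rw [Metric.mem_ball, Real.dist_eq]
    rw [abs_sub_comm] at h2
    calc |T Q f - T P f| ≤ |T Q f - T P' f| + |T P' f - T P f| := abs_sub_le _ _ _
      _ < ε := by linarith
      _ ≤ δ f := hεI f hf

lemma exists_finset_separating {C F : Set (ProbabilityMeasure Ω)} (hC : IsCompact C)
    (hF : IsClosed F) (hCF : Disjoint C F) :
    ∃ (S : Finset (Ω →ᵇ ℝ)) (ε : ℝ), 0 < ε ∧ ∀ P ∈ C, ∀ Q ∈ F,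
      ∃ f ∈ S, ε ≤ |∫ ω, f ω ∂(P : Measure Ω) - ∫ ω, f ω ∂(Q : Measure Ω)| := by
  classical
  refine hC.induction_on (p := fun t => ∃ (S : Finset (Ω →ᵇ ℝ)) (ε : ℝ), 0 < ε ∧ ∀ P ∈ t,
    ∀ Q ∈ F, ∃ f ∈ S, ε ≤ |∫ ω, f ω ∂(P : Measure Ω) - ∫ ω, f ω ∂(Q : Measure Ω)|) ?_ ?_ ?_ ?_
  · exact ⟨∅, 1, one_pos, fun P hP => hP.elim⟩
  · rintro s t hst ⟨S, ε, hε, h⟩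
    exact ⟨S, ε, hε, fun P hP => h P (hst hP)⟩
  · rintro s t ⟨S, ε, hε, h⟩ ⟨S', ε', hε', h'⟩
    refine ⟨S ∪ S', min ε ε', lt_min hε hε', fun P hP Q hQ => ?_⟩
    rcases hP with hP | hP
    · obtain ⟨f, hf, hfε⟩ := h P hP Q hQ
      exact ⟨f, Finset.mem_union_left _ hf, (min_le_left _ _).trans hfε⟩
    · obtain ⟨f, hf, hfε⟩ := h' P hP Q hQ
      exact ⟨f, Finset.mem_union_right _ hf, (min_le_right _ _).trans hfε⟩
  · intro P hP
    obtain ⟨t, ht, h⟩ := exists_finset_separating_point hF (Set.disjoint_left.1 hCF hP)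
    exact ⟨t, mem_nhdsWithin_of_mem_nhds ht, h⟩

end Separation

/-! ### Hoeffding bounds for empirical means -/

section Concentration

open ProbabilityTheory

/-- The empirical mean of `f` along the sample `x`. -/
def sampleMean {Ω : Type*} {n : ℕ} (f : Ω → ℝ) (x : Fin n → Ω) : ℝ := (∑ i, f (x i)) / n

variable {Ω : Type*} [MeasurableSpace Ω]

lemma measurable_sampleMean {n : ℕ} {f : Ω → ℝ} (hf : Measurable f) :
    Measurable (sampleMean f : (Fin n → Ω) → ℝ) := by
  unfold sampleMean
  fun_prop

/-- One-sided Hoeffding bound for the empirical mean. -/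
lemma measureReal_sampleMean_ge_le (P : Measure Ω) [IsProbabilityMeasure P] {f : Ω → ℝ}
    (hf : Measurable f) {M : ℝ} (hM : 0 < M) (hfM : ∀ ω, f ω ∈ Set.Icc (-M) M) {ε : ℝ}
    (hε : 0 ≤ ε) {n : ℕ} (hn : 0 < n) :
    (Measure.pi fun _ : Fin n => P).real {x | ε ≤ sampleMean f x - ∫ ω, f ω ∂P}
      ≤ Real.exp (-(ε ^ 2 / (2 * M ^ 2)) * n) := by
  have hn' : (0 : ℝ) < n := by exact_mod_cast hn
  have hint : ∀ i : Fin n, ∫ x, f (x i) ∂(Measure.pi fun _ : Fin n => P) = ∫ ω, f ω ∂P :=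
    fun i => by
      have h := integral_map (μ := Measure.pi fun _ : Fin n => P) (f := f)
        (measurable_pi_apply i).aemeasurable hf.aestronglyMeasurable
      rw [← h]
      exact congrArg (fun ν => ∫ ω, f ω ∂ν)
        (measurePreserving_eval (fun _ : Fin n => P) i).map_eq
  have hsub : ∀ i ∈ (Finset.univ : Finset (Fin n)),
      HasSubgaussianMGF (fun x : Fin n → Ω => f (x i) - ∫ ω, f ω ∂P)
        ((‖M - -M‖₊ / 2) ^ 2) (Measure.pi fun _ : Fin n => P) := fun i _ => by
    have := hasSubgaussianMGF_of_mem_Icc (μ := Measure.pi fun _ : Fin n => P)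
      (X := fun x => f (x i)) (hf.comp (measurable_pi_apply i)).aemeasurable
      (Eventually.of_forall fun x => hfM (x i))
    rwa [hint i] at this
  have hind : iIndepFun (fun i (x : Fin n → Ω) => f (x i) - ∫ ω, f ω ∂P)
      (Measure.pi fun _ : Fin n => P) :=
    iIndepFun_pi (X := fun _ ω => f ω - ∫ ω, f ω ∂P) fun _ => (hf.sub_const _).aemeasurable
  have key := HasSubgaussianMGF.measure_sum_ge_le_of_iIndepFun hind hsub
    (mul_nonneg hn'.le hε)
  have hset : {x : Fin n → Ω | ε ≤ sampleMean f x - ∫ ω, f ω ∂P}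
      = {x | n * ε ≤ ∑ i, (f (x i) - ∫ ω, f ω ∂P)} := by
    ext x
    simp only [Set.mem_ofPred_eq, sampleMean, Finset.sum_sub_distrib, Finset.sum_const,
      Finset.card_univ, Fintype.card_fin, nsmul_eq_mul]
    rw [le_sub_iff_add_le, le_sub_iff_add_le, le_div_iff₀ hn']
    constructor <;> intro h <;> linarith
  rw [hset]
  refine key.trans (le_of_eq ?_)
  congr 1
  -- Values in `[-M, M]` give each summand the sub-Gaussian parameter `M ^ 2`, half the range
  -- squared.
  have : ((∑ i : Fin n, (‖M - -M‖₊ / 2) ^ 2 : NNReal) : ℝ) = n * M ^ 2 := by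
    have : |M + M| = 2 * M := by rw [abs_of_pos (by linarith)]; ring
    simp [this]
  rw [this]
  field_simp

lemma measureReal_abs_sampleMean_ge_le (P : Measure Ω) [IsProbabilityMeasure P] {f : Ω → ℝ}
    (hf : Measurable f) {M : ℝ} (hM : 0 < M) (hfM : ∀ ω, f ω ∈ Set.Icc (-M) M) {ε : ℝ}
    (hε : 0 ≤ ε) {n : ℕ} (hn : 0 < n) :
    (Measure.pi fun _ : Fin n => P).real {x | ε ≤ |sampleMean f x - ∫ ω, f ω ∂P|}
      ≤ 2 * Real.exp (-(ε ^ 2 / (2 * M ^ 2)) * n) := by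
  have h1 := measureReal_sampleMean_ge_le P hf hM hfM hε hn
  have h2 := measureReal_sampleMean_ge_le P hf.neg hM
    (fun ω => ⟨neg_le_neg (hfM ω).2, by simpa using neg_le_neg (hfM ω).1⟩) hε hn
  rw [two_mul]
  refine le_trans ?_ (add_le_add h1 h2)
  refine (measureReal_mono ?_).trans (measureReal_union_le _ _)
  intro x hx
  rw [Set.mem_ofPred_eq] at hx
  rcases le_abs.1 hx with h | h
  · exact Or.inl h
  · refine Or.inr ?_
    simp only [Set.mem_ofPred_eq, sampleMean, Pi.neg_apply, Finset.sum_neg_distrib,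
      integral_neg, neg_div] at h ⊢
    linarith

end Concentration

/-! ### Error probabilities of tests -/

section Errors

variable {Ω : Type*} [MeasurableSpace Ω] {n : ℕ}

namespace SampleTest

lemma integrable_toFun (K : SampleTest Ω n) (P : ProbabilityMeasure Ω) :
    Integrable K.toFun (Measure.pi fun _ : Fin n => (P : Measure Ω)) :=
  Integrable.of_mem_Icc 0 1 K.measurable_toFun.aemeasurable (Eventually.of_forall K.mem_Icc)

lemma errorII_eq (K : SampleTest Ω n) (P : ProbabilityMeasure Ω) :
    K.errorII P = 1 - K.errorI P := by
  rw [errorII, errorI, integral_sub (integrable_const _) (K.integrable_toFun P)]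
  simp

lemma errorI_nonneg (K : SampleTest Ω n) (P : ProbabilityMeasure Ω) : 0 ≤ K.errorI P :=
  integral_nonneg fun x => (K.mem_Icc x).1

lemma errorII_nonneg (K : SampleTest Ω n) (P : ProbabilityMeasure Ω) : 0 ≤ K.errorII P :=
  integral_nonneg fun x => sub_nonneg.2 (K.mem_Icc x).2

lemma errorI_le_alpha (K : SampleTest Ω n) {Θ : Set (ProbabilityMeasure Ω)}
    {P : ProbabilityMeasure Ω} (hP : P ∈ Θ) : K.errorI P ≤ K.alpha Θ := by
  refine le_ciSup (f := fun Q : Θ => K.errorI Q) ⟨1, ?_⟩ ⟨P, hP⟩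
  rintro _ ⟨Q, rfl⟩
  have h1 := K.errorII_nonneg (Q : ProbabilityMeasure Ω)
  have h2 := K.errorII_eq (Q : ProbabilityMeasure Ω)
  change K.errorI (Q : ProbabilityMeasure Ω) ≤ 1
  linarith

lemma errorII_le_beta (K : SampleTest Ω n) {Θ : Set (ProbabilityMeasure Ω)}
    {P : ProbabilityMeasure Ω} (hP : P ∈ Θ) : K.errorII P ≤ K.beta Θ := by
  refine le_ciSup (f := fun Q : Θ => K.errorII Q) ⟨1, ?_⟩ ⟨P, hP⟩
  rintro _ ⟨Q, rfl⟩
  have h1 := K.errorI_nonneg (Q : ProbabilityMeasure Ω)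
  have h2 := K.errorII_eq (Q : ProbabilityMeasure Ω)
  change K.errorII (Q : ProbabilityMeasure Ω) ≤ 1
  linarith

lemma beta_nonneg (K : SampleTest Ω n) (Θ : Set (ProbabilityMeasure Ω)) : 0 ≤ K.beta Θ :=
  Real.iSup_nonneg fun P => K.errorII_nonneg P

/-- The nonrandomized test that rejects on the measurable set `R`. -/
def ofRejectionRegion (R : Set (Fin n → Ω)) (hR : MeasurableSet R) : SampleTest Ω n where
  toFun := R.indicator 1
  measurable_toFun := measurable_one.indicator hR
  mem_Icc x := by by_cases h : x ∈ R <;> simp [h]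

lemma errorI_ofRejectionRegion {R : Set (Fin n → Ω)} (hR : MeasurableSet R)
    (P : ProbabilityMeasure Ω) :
    (ofRejectionRegion R hR).errorI P
      = (Measure.pi fun _ : Fin n => (P : Measure Ω)).real R :=
  integral_indicator_one hR

lemma errorII_ofRejectionRegion {R : Set (Fin n → Ω)} (hR : MeasurableSet R)
    (P : ProbabilityMeasure Ω) :
    (ofRejectionRegion R hR).errorII P
      = (Measure.pi fun _ : Fin n => (P : Measure Ω)).real Rᶜ := by
  rw [errorII_eq, errorI_ofRejectionRegion, probReal_compl_eq_one_sub hR]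

end SampleTest

lemma distinguishable_of_exponential_tests {Θ₀ Θ₁ : Set (ProbabilityMeasure Ω)}
    (h : ∃ (K : (n : ℕ) → SampleTest Ω n) (c : ℝ) (n₀ : ℕ), 0 < c ∧ ∀ n : ℕ, n₀ < n →
      (K n).alpha Θ₀ ≤ Real.exp (-c * n) ∧ (K n).beta Θ₁ ≤ Real.exp (-c * n)) :
    Distinguishable Θ₀ Θ₁ := by
  obtain ⟨K, c, n₀, hc, hK⟩ := h
  intro a ha _
  have hlim : Tendsto (fun n : ℕ => Real.exp (-c * n)) atTop (𝓝 0) :=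
    Real.tendsto_exp_atBot.comp
      ((tendsto_natCast_atTop_atTop (R := ℝ)).const_mul_atTop_of_neg (neg_lt_zero.2 hc))
  obtain ⟨n₁, hn₁⟩ := eventually_atTop.1 (hlim.eventually (gt_mem_nhds ha))
  -- At small sample sizes the test never rejects: its level is `0 < a`, and its type II error does
  -- not affect the limit.
  refine ⟨fun n => if max n₀ n₁ < n then K n else .ofRejectionRegion ∅ .empty,
    fun n _ => ?_, ?_⟩
  · dsimp only
    split_ifs with hn
    · exact ((hK n (by omega)).1).trans_lt (hn₁ n (by omega))
    · refine lt_of_le_of_lt (Real.iSup_le (fun P => ?_) le_rfl) ha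
      simp [SampleTest.errorI_ofRejectionRegion]
  · refine tendsto_of_tendsto_of_tendsto_of_le_of_le' tendsto_const_nhds hlim
      (Eventually.of_forall fun n => SampleTest.beta_nonneg _ _) ?_
    filter_upwards [eventually_gt_atTop (max n₀ n₁)] with n hn
    rw [if_pos hn]
    exact (hK n (by omega)).2

end Errors

/-! ### The `τ`-topology and indistinguishability -/

section TauTopology

variable {Ω : Type*} [MeasurableSpace Ω]

lemma continuous_tauTopology_measureReal {A : Set Ω} (hA : MeasurableSet A) :
    Continuous[tauTopology Ω, inferInstance]
      (fun P : ProbabilityMeasure Ω => (P : Measure Ω).real A) := by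
  let _ := tauTopology Ω
  have h : Continuous[tauTopology Ω, inferInstance] (fun P : ProbabilityMeasure Ω => P A) :=
    continuous_iInf_dom (i := (⟨A, hA⟩ : {B : Set Ω // MeasurableSet B}))
      continuous_induced_dom
  exact NNReal.continuous_coe.comp h

lemma RelCompactTau.errorI_le_alpha {Θ : Set (ProbabilityMeasure Ω)} (hΘ : RelCompactTau Θ)
    {P : ProbabilityMeasure Ω} (hP : P ∈ closure[tauTopology Ω] Θ) {n : ℕ}
    (K : SampleTest Ω n) : K.errorI P ≤ K.alpha Θ := by
  let _ := tauTopology Ω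
  have hcont := continuousOn_integral_pi (μ := fun P : ProbabilityMeasure Ω => (P : Measure Ω))
    hΘ (fun A hA => (continuous_tauTopology_measureReal hA).continuousOn) K.measurable_toFun
    K.mem_Icc
  exact ((hcont P hP).mono subset_closure).closure_le hP continuousWithinAt_const
    fun Q hQ => K.errorI_le_alpha hQ

lemma RelCompactTau.errorII_le_beta {Θ : Set (ProbabilityMeasure Ω)} (hΘ : RelCompactTau Θ)
    {P : ProbabilityMeasure Ω} (hP : P ∈ closure[tauTopology Ω] Θ) {n : ℕ}
    (K : SampleTest Ω n) : K.errorII P ≤ K.beta Θ := by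
  let _ := tauTopology Ω
  have hcont := continuousOn_integral_pi (μ := fun P : ProbabilityMeasure Ω => (P : Measure Ω))
    hΘ (fun A hA => (continuous_tauTopology_measureReal hA).continuousOn)
    (measurable_const.sub K.measurable_toFun)
    (fun x => ⟨sub_nonneg.2 (K.mem_Icc x).2, sub_le_self _ (K.mem_Icc x).1⟩)
  exact ((hcont P hP).mono subset_closure).closure_le hP continuousWithinAt_const
    fun Q hQ => K.errorII_le_beta hQ

variable [TopologicalSpace Ω] [BorelSpace Ω]

/-- An affine rescaling brings `f` into `[0, 1]`, where the uniform approximation by indicators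
applies. -/
lemma continuous_tauTopology_integral (f : Ω →ᵇ ℝ) :
    Continuous[tauTopology Ω, inferInstance]
      (fun P : ProbabilityMeasure Ω => ∫ ω, f ω ∂(P : Measure Ω)) := by
  let _ := tauTopology Ω
  set M : ℝ := ‖f‖ + 1
  have hM : 0 < M := by positivity
  have hfM : ∀ ω, |f ω| ≤ M := fun ω =>
    (f.norm_coe_le_norm ω).trans (le_add_of_nonneg_right zero_le_one)
  have hcont : Continuous[tauTopology Ω, inferInstance]
      (fun P : ProbabilityMeasure Ω => ∫ ω, (f ω + M) / (2 * M) ∂(P : Measure Ω)) := by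
    rw [← continuousOn_univ]
    refine continuousOn_integral_of_mem_Icc
      (μ := fun P : ProbabilityMeasure Ω => (P : Measure Ω))
      (fun A hA => (continuous_tauTopology_measureReal hA).continuousOn)
      ((f.continuous.measurable.add_const _).div_const _) fun ω => ?_
    have := abs_le.1 (hfM ω)
    constructor
    · exact div_nonneg (by linarith) (by positivity)
    · rw [div_le_one (by positivity)]
      linarith
  have heq : (fun P : ProbabilityMeasure Ω => ∫ ω, f ω ∂(P : Measure Ω))
      = fun P : ProbabilityMeasure Ω =>
        2 * M * (∫ ω, (f ω + M) / (2 * M) ∂(P : Measure Ω)) - M := by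
    funext P
    rw [integral_div, integral_add (f.integrable _) (integrable_const _)]
    simp only [integral_const, probReal_univ, one_smul]
    field_simp
    ring
  rw [heq]
  exact (continuous_const.mul hcont).sub continuous_const

lemma continuous_id_tauTopology_weak :
    Continuous[tauTopology Ω, inferInstance] (id : ProbabilityMeasure Ω → _) := by
  rw [continuous_iff_le_induced, induced_id]
  refine le_of_nhds_le_nhds fun P => ?_
  refine ProbabilityMeasure.tendsto_iff_forall_integral_tendsto.2 fun f => ?_
  exact @Continuous.tendsto _ _ (tauTopology Ω) _ _ (continuous_tauTopology_integral f) P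

/-- The `τ`-topology is finer than the weak one, so the `τ`-closure is weakly compact, and weakly
closed because the weak topology is Hausdorff. -/
lemma RelCompactTau.closure_subset [HasOuterApproxClosed Ω] {Θ : Set (ProbabilityMeasure Ω)}
    (hΘ : RelCompactTau Θ) : closure Θ ⊆ closure[tauTopology Ω] Θ := by
  have himg : IsCompact (id '' closure[tauTopology Ω] Θ) :=
    @IsCompact.image _ _ (tauTopology Ω) _ _ _ hΘ continuous_id_tauTopology_weak
  rw [Set.image_id] at himg
  exact closure_minimal (@subset_closure _ (tauTopology Ω) Θ) himg.isClosed

lemma indistinguishable_of_relCompactTau [HasOuterApproxClosed Ω]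
    {Θ₀ Θ₁ : Set (ProbabilityMeasure Ω)} (h₀ : RelCompactTau Θ₀) (h₁ : RelCompactTau Θ₁)
    (h : (closure Θ₀ ∩ closure Θ₁).Nonempty) : Indistinguishable Θ₀ Θ₁ := by
  obtain ⟨P, hP₀, hP₁⟩ := h
  intro n _ K
  have h0 := h₀.errorI_le_alpha (h₀.closure_subset hP₀) K
  have h1 := h₁.errorII_le_beta (h₁.closure_subset hP₁) K
  have := K.errorII_eq P
  linarith

end TauTopology

/-! ### Exponentially consistent tests -/

section ExponentialTests

variable {Ω : Type*} [TopologicalSpace Ω] [MeasurableSpace Ω] [BorelSpace Ω]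

/-- The rejection region of the minimum distance test: no `P ∈ Θ` has all integrals of `f ∈ S`
within `ε` of the empirical means. -/
def farRegion (S : Finset (Ω →ᵇ ℝ)) (ε : ℝ) (Θ : Set (ProbabilityMeasure Ω)) (n : ℕ) :
    Set (Fin n → Ω) :=
  {x | ∀ P ∈ Θ, ∃ f ∈ S, ε ≤ |sampleMean f x - ∫ ω, f ω ∂(P : Measure Ω)|}

/-- `Θ` may be uncountable, but the complement is the preimage of an open subset of `S → ℝ` under
the measurable vector of empirical means. -/
lemma measurableSet_farRegion (S : Finset (Ω →ᵇ ℝ)) (ε : ℝ) (Θ : Set (ProbabilityMeasure Ω))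
    (n : ℕ) : MeasurableSet (farRegion S ε Θ n) := by
  have hT : Measurable fun (x : Fin n → Ω) (f : S) => sampleMean (f : Ω →ᵇ ℝ) x :=
    measurable_pi_lambda _ fun f => measurable_sampleMean f.1.continuous.measurable
  have hopen : IsOpen (⋃ P ∈ Θ, ⋂ f : S,
      {v : S → ℝ | |v f - ∫ ω, (f : Ω →ᵇ ℝ) ω ∂(P : Measure Ω)| < ε}) :=
    isOpen_biUnion fun P _ => isOpen_iInter_of_finite fun f =>
      isOpen_lt (by fun_prop) continuous_const
  convert (hT hopen.measurableSet).compl using 1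
  ext x
  simp [farRegion]

lemma measureReal_exists_abs_sampleMean_ge_le (S : Finset (Ω →ᵇ ℝ)) {M : ℝ} (hM : 0 < M)
    (hSM : ∀ f ∈ S, ‖f‖ ≤ M) {ε : ℝ} (hε : 0 ≤ ε) (P : Measure Ω) [IsProbabilityMeasure P]
    {n : ℕ} (hn : 0 < n) :
    (Measure.pi fun _ : Fin n => P).real
        {x | ∃ f ∈ S, ε ≤ |sampleMean f x - ∫ ω, f ω ∂P|}
      ≤ S.card * (2 * Real.exp (-(ε ^ 2 / (2 * M ^ 2)) * n)) := by
  have : {x : Fin n → Ω | ∃ f ∈ S, ε ≤ |sampleMean f x - ∫ ω, f ω ∂P|}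
      = ⋃ f ∈ S, {x | ε ≤ |sampleMean f x - ∫ ω, f ω ∂P|} := by
    ext x; simp
  rw [this, ← nsmul_eq_mul]
  refine (measureReal_biUnion_finset_le _ _).trans (Finset.sum_le_card_nsmul _ _ _ fun f hf => ?_)
  exact measureReal_abs_sampleMean_ge_le P f.continuous.measurable hM
    (fun ω => abs_le.1 ((f.norm_coe_le_norm ω).trans (hSM f hf))) hε hn

lemma exists_exponential_tests {Θ₀ Θ₁ : Set (ProbabilityMeasure Ω)} {S : Finset (Ω →ᵇ ℝ)}
    {ε : ℝ} (hε : 0 < ε) (hsep : ∀ P ∈ Θ₀, ∀ Q ∈ Θ₁,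
      ∃ f ∈ S, ε ≤ |∫ ω, f ω ∂(P : Measure Ω) - ∫ ω, f ω ∂(Q : Measure Ω)|) :
    ∃ (K : (n : ℕ) → SampleTest Ω n) (c : ℝ) (n₀ : ℕ), 0 < c ∧ ∀ n : ℕ, n₀ < n →
      (K n).alpha Θ₀ ≤ Real.exp (-c * n) ∧ (K n).beta Θ₁ ≤ Real.exp (-c * n) := by
  set M : ℝ := 1 + ∑ f ∈ S, ‖f‖
  have hM : 0 < M := by positivity
  have hSM : ∀ f ∈ S, ‖f‖ ≤ M := fun f hf =>
    (Finset.single_le_sum (fun g _ => norm_nonneg g) hf).trans (le_add_of_nonneg_left zero_le_one)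
  -- Half of the Hoeffding exponent at deviation `ε / 2`; the other half absorbs the union-bound
  -- factor `2 * S.card` once `n₀ < n`.
  set c : ℝ := (ε / 2) ^ 2 / (2 * M ^ 2) / 2 with hc
  have hcpos : 0 < c := by positivity
  have hlim : Tendsto (fun n : ℕ => S.card * 2 * Real.exp (-c * n)) atTop (𝓝 0) := by
    have h := Real.tendsto_exp_atBot.comp
      ((tendsto_natCast_atTop_atTop (R := ℝ)).const_mul_atTop_of_neg (neg_lt_zero.2 hcpos))
    simpa using h.const_mul (S.card * 2 : ℝ)
  obtain ⟨n₀, hn₀⟩ := eventually_atTop.1 (hlim.eventually (gt_mem_nhds one_pos))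
  have hbound : ∀ n : ℕ, n₀ < n →
      S.card * (2 * Real.exp (-((ε / 2) ^ 2 / (2 * M ^ 2)) * n)) ≤ Real.exp (-c * n) := by
    intro n hn
    have h1 : Real.exp (-((ε / 2) ^ 2 / (2 * M ^ 2)) * n)
        = Real.exp (-c * n) * Real.exp (-c * n) := by
      rw [← Real.exp_add]; congr 1; rw [hc]; ring
    rw [h1]
    nlinarith [hn₀ n hn.le, Real.exp_pos (-c * n)]
  refine ⟨fun n => .ofRejectionRegion _ (measurableSet_farRegion S (ε / 2) Θ₀ n), c, n₀, hcpos,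
    fun n hn => ⟨?_, ?_⟩⟩
  · refine Real.iSup_le (fun P => ?_) (Real.exp_pos _).le
    rw [SampleTest.errorI_ofRejectionRegion]
    refine le_trans (measureReal_mono fun x hx => hx P P.2) ((measureReal_exists_abs_sampleMean_ge_le
      S hM hSM (half_pos hε).le (P : Measure Ω) (by omega)).trans (hbound n hn))
  · refine Real.iSup_le (fun Q => ?_) (Real.exp_pos _).le
    rw [SampleTest.errorII_ofRejectionRegion]
    refine le_trans (measureReal_mono fun x hx => ?_) ((measureReal_exists_abs_sampleMean_ge_le
      S hM hSM (half_pos hε).le (Q : Measure Ω) (by omega)).trans (hbound n hn))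
    -- Acceptance means that some `P ∈ Θ₀` is within `ε / 2` of all empirical means. Since some `f ∈
    -- S` separates `P` from `Q` by `ε`, its empirical mean is at least `ε / 2` away from its
    -- `Q`-integral.
    simp only [farRegion, Set.mem_compl_iff, Set.mem_ofPred_eq, not_forall, not_exists, not_and,
      not_le] at hx
    obtain ⟨P, hP, hx⟩ := hx
    obtain ⟨f, hf, hPQ⟩ := hsep P hP Q Q.2
    refine ⟨f, hf, ?_⟩
    have h1 := hx f hf
    have h2 := abs_sub_le (∫ ω, f ω ∂(P : Measure Ω)) (sampleMean f x)
      (∫ ω, f ω ∂((Q : ProbabilityMeasure Ω) : Measure Ω))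
    rw [abs_sub_comm _ (sampleMean f x)] at h2
    linarith

lemma exists_finset_separating_of_relCompactWeak {Θ₀ Θ₁ : Set (ProbabilityMeasure Ω)}
    (h : RelCompactWeak Θ₀ ∨ RelCompactWeak Θ₁) (hdisj : closure Θ₀ ∩ closure Θ₁ = ∅) :
    ∃ (S : Finset (Ω →ᵇ ℝ)) (ε : ℝ), 0 < ε ∧ ∀ P ∈ Θ₀, ∀ Q ∈ Θ₁,
      ∃ f ∈ S, ε ≤ |∫ ω, f ω ∂(P : Measure Ω) - ∫ ω, f ω ∂(Q : Measure Ω)| := by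
  rw [← Set.disjoint_iff_inter_eq_empty] at hdisj
  rcases h with h | h
  · obtain ⟨S, ε, hε, hS⟩ := exists_finset_separating h isClosed_closure hdisj
    exact ⟨S, ε, hε, fun P hP Q hQ => hS P (subset_closure hP) Q (subset_closure hQ)⟩
  · obtain ⟨S, ε, hε, hS⟩ := exists_finset_separating h isClosed_closure hdisj.symm
    refine ⟨S, ε, hε, fun P hP Q hQ => ?_⟩
    simp_rw [abs_sub_comm (∫ ω, _ ∂(P : Measure Ω))]
    exact hS Q (subset_closure hQ) P (subset_closure hP)

end ExponentialTests

end IIDTesting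

end

theorem theorem2p4 {Ω : Type*} [TopologicalSpace Ω] [PolishSpace Ω] [MeasurableSpace Ω]
    [BorelSpace Ω] (Θ₀ Θ₁ : Set (ProbabilityMeasure Ω)) :
    (IIDTesting.RelCompactTau Θ₀ → IIDTesting.RelCompactTau Θ₁ →
      (closure Θ₀ ∩ closure Θ₁).Nonempty → IIDTesting.Indistinguishable Θ₀ Θ₁) ∧
    (IIDTesting.RelCompactWeak Θ₀ ∨ IIDTesting.RelCompactWeak Θ₁ →
      closure Θ₀ ∩ closure Θ₁ = ∅ →
        IIDTesting.Distinguishable Θ₀ Θ₁ ∧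
        ∃ (K : (n : ℕ) → IIDTesting.SampleTest Ω n) (c : ℝ) (n₀ : ℕ), 0 < c ∧
          ∀ n : ℕ, n₀ < n →
            (K n).alpha Θ₀ ≤ Real.exp (-c * n) ∧ (K n).beta Θ₁ ≤ Real.exp (-c * n)) := by
  -- A compatible metric provides `HasOuterApproxClosed Ω`, on which Hausdorffness of the weak
  -- topology rests.
  let _ := TopologicalSpace.upgradeIsCompletelyMetrizable Ω
  refine ⟨fun h₀ h₁ h => IIDTesting.indistinguishable_of_relCompactTau h₀ h₁ h,
    fun h hdisj => ?_⟩
  obtain ⟨S, ε, hε, hsep⟩ := IIDTesting.exists_finset_separating_of_relCompactWeak h hdisj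
  have htests := IIDTesting.exists_exponential_tests hε hsep
  exact ⟨IIDTesting.distinguishable_of_exponential_tests htests, htests⟩
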